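/- For a real random variable $L$ let $\delta_L(\varepsilon)=\mathbb E\big[(1-e^{-(L-\varepsilon)})^+\big]$ be its induced privacy curve, and let $\varepsilon_L(\delta)=\inf\{\varepsilon\ge 0:\delta_L(\varepsilon)\le\delta\}$ be its inverse. The exponential tilting of $L$ with parameter $t$, defined if $\mathbb E[e^{tL}]<\infty$, is a random variable $\tilde L$ with law $P_{\tilde L}(B)=\mathbb E[e^{tL}]^{-1}\int_B e^{tu}\,dP_L(u)$. Let $\Phi$ be the standard normal distribution function. Let $L_1,L_2,\dots$ be independent real random variables (for instance privacy loss random variables of mechanisms $\mathcal M_1,\mathcal M_2,\dots$), and let $L^{(n)}=L_1+\dots+L_n$, with standard deviation $\sigma_{L^{(n)}}$. Assume that there are constants $\mathrm{KL}>0$, $\mathrm V>0$ and $\mathrm P\in\mathbb R$ such that, for every sequence $t=t_n\ge 0$ with $t_n=o(n^{-1/3})$, for all large $n$ the tiltings $\tilde L_1,\dots,\tilde L_n$ with parameter $t_n$ exist and have finite third absolute moments, and, as $n\to\infty$, $$\frac1n\,\mathbb E[\tilde L^{(n)}]\to\mathrm{KL},\qquad \frac1n\,\sigma^2_{\tilde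 L^{(n)}}\to\mathrm V,\qquad \frac1n\sum_{j=1}^n\mathbb E\big[|\tilde L_j-\mathbb E[\tilde L_j]|^3\big]\to\mathrm P,$$ where $\tilde L^{(n)}$ is the tilting of $L^{(n)}$ with parameter $t_n$. Then for every $\delta\in(0,1/2)$, as $n\to\infty$, $$\delta_{L^{(n)}}\big(\mathbb E[L^{(n)}]-\Phi^{-1}(\delta)\,\sigma_{L^{(n)}}\big)\to\delta \qquad\text{and}\qquad \frac{\varepsilon_{L^{(n)}}(\delta)-\mathbb E[L^{(n)}]}{\sigma_{L^{(n)}}}\to-\Phi^{-1}(\delta).$$ -/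

import Mathlib

open MeasureTheory ProbabilityTheory Filter Topology Asymptotics

noncomputable section

/-- The privacy curve induced by a real random variable `L`:
`δ_L(ε) = E[(1 - exp(-(L - ε)))⁺]`. The integrand takes values in `[0,1]`. -/
def privacyCurve {Ω : Type*} [MeasurableSpace Ω] (μ : Measure Ω) (L : Ω → ℝ) (ε : ℝ) : ℝ :=
  ∫ ω, max 0 (1 - Real.exp (-(L ω - ε))) ∂μ

/-- The inverse of the (nonincreasing) privacy curve: the smallest `ε ≥ 0` at which the
privacy curve is at most `δ`. -/
def privacyCurveInv {Ω : Type*} [MeasurableSpace Ω] (μ : Measure Ω) (L : Ω → ℝ) (δ : ℝ) : ℝ :=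
  sInf {ε : ℝ | 0 ≤ ε ∧ privacyCurve μ L ε ≤ δ}

/-- The distribution function `Φ` of the standard normal law. -/
def stdNormalCDF (x : ℝ) : ℝ := cdf (gaussianReal 0 1) x

/-- The inverse `Φ⁻¹` of the standard normal distribution function (meaningful on `(0,1)`,
where `Φ : ℝ → (0,1)` is a bijection). -/
def stdNormalCDFInv (p : ℝ) : ℝ := Function.invFun stdNormalCDF p

/-- The sum of the first `n` variables of the sequence (indexed from `0`). -/
def partialSum {Ω : Type*} (L : ℕ → Ω → ℝ) (n : ℕ) (ω : Ω) : ℝ := ∑ j ∈ Finset.range n, L j ω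

/-- The law of the exponential tilting with parameter `t` of a random variable `L`:
`B ↦ (1 / M_L(t)) ∫_B exp(t u) dP_L(u)`. -/
def tiltedLaw {Ω : Type*} [MeasurableSpace Ω] (μ : Measure Ω) (L : Ω → ℝ) (t : ℝ) : Measure ℝ :=
  (μ.map L).tilted (fun u => t * u)

/-- The mean of the exponential tilting of `L` with parameter `t`. -/
def tiltedMean {Ω : Type*} [MeasurableSpace Ω] (μ : Measure Ω) (L : Ω → ℝ) (t : ℝ) : ℝ :=
  ∫ u, u ∂(tiltedLaw μ L t)

/-- The variance of the exponential tilting of `L` with parameter `t`. -/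
def tiltedVariance {Ω : Type*} [MeasurableSpace Ω] (μ : Measure Ω) (L : Ω → ℝ) (t : ℝ) : ℝ :=
  ∫ u, (u - tiltedMean μ L t) ^ 2 ∂(tiltedLaw μ L t)

/-- The third absolute central moment of the exponential tilting of `L` with parameter `t`. -/
def tiltedThirdAbsMoment {Ω : Type*} [MeasurableSpace Ω] (μ : Measure Ω) (L : Ω → ℝ) (t : ℝ) : ℝ :=
  ∫ u, |u - tiltedMean μ L t| ^ 3 ∂(tiltedLaw μ L t)

/-- The tilting of `L` with parameter `t` exists (finite moment generating function at `t`)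
and has a finite third absolute moment. -/
def TiltFinite {Ω : Type*} [MeasurableSpace Ω] (μ : Measure Ω) (L : Ω → ℝ) (t : ℝ) : Prop :=
  Integrable (fun ω => Real.exp (t * L ω)) μ ∧
    Integrable (fun u : ℝ => |u| ^ 3) (tiltedLaw μ L t)

/-- There are constants `KL, V > 0` and `P` such that, along every sequence of tilts
`0 ≤ t = o(n^(-1/3))`, the tilted mean and variance of `L^(n)` and the sum of the tilted third
absolute central moments of the summands (all of which are finite for large `n`), divided by `n`,
converge to `KL`, `V` and `P`. -/
def MomentAssumption {Ω : Type*} [MeasurableSpace Ω] (μ : Measure Ω) (L : ℕ → Ω → ℝ) : Prop :=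
  ∃ KL V P : ℝ, 0 < KL ∧ 0 < V ∧
    ∀ t : ℕ → ℝ, (∀ n, 0 ≤ t n) →
      t =o[atTop] (fun n : ℕ => (n : ℝ) ^ (-(1 / 3) : ℝ)) →
      (∀ᶠ n : ℕ in atTop, ∀ j < n, TiltFinite μ (L j) (t n)) ∧
      Tendsto (fun n : ℕ => tiltedMean μ (partialSum L n) (t n) / n) atTop (𝓝 KL) ∧
      Tendsto (fun n : ℕ => tiltedVariance μ (partialSum L n) (t n) / n) atTop (𝓝 V) ∧
      Tendsto (fun n : ℕ => (∑ j ∈ Finset.range n, tiltedThirdAbsMoment μ (L j) (t n)) / n)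
        atTop (𝓝 P)

/-- The mean of a random variable. -/
def meanOf {Ω : Type*} [MeasurableSpace Ω] (μ : Measure Ω) (X : Ω → ℝ) : ℝ := ∫ ω, X ω ∂μ

/-- The standard deviation of a random variable. -/
def stdDev {Ω : Type*} [MeasurableSpace Ω] (μ : Measure Ω) (X : Ω → ℝ) : ℝ :=
  Real.sqrt (variance X μ)

end

/-!
The limit theorem concerns only the untilted sums, so the moment assumption is needed at the
single tilt sequence `t = 0`. There it says that the `L j` have third moments, that the mean and
variance of `S n = partialSum L n` grow linearly, and that `∑ E|L j - E L j|³ = O(n)`. As the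
standard deviation `s n` grows like `√n`, this is Lyapunov's condition, and
`(S n - E (S n)) / s n` converges in law to a standard normal variable
(`tendsto_charFun_of_lyapunov`, `tendsto_tail_partialSum`). The central limit theorem is proved by
comparing each characteristic function with that of the Gaussian of equal variance, up to a
multiple of the third absolute moment, and applying Lévy's continuity theorem.

At `ε = E (S n) + x * s n` the privacy curve is the expectation of `(1 - exp (-s n (Z - x)))⁺`,
where `Z` is the standardized sum. Because `s n → ∞` this kernel degenerates to the indicator of
`Z > x`, and the privacy curve tends to `1 - Φ(x)` (`tendsto_privacyCurve_of_tendsto_tail`); for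
`x = -Φ⁻¹(δ)` this is `δ`. Since `Φ` is strictly increasing and the privacy curve is antitone, the
inverse is eventually squeezed between `E (S n) + (x ± η) * s n`
(`tendsto_privacyCurveInv_of_tendsto`); these thresholds are nonnegative for large `n` because the
mean outgrows the standard deviation.
-/

/-! ### Pointwise Taylor bounds -/

/-- Second-order Taylor bound for `x ↦ exp (i x)`, valid for all real `x`. -/
lemma norm_exp_mul_I_sub_taylor_two_le (x : ℝ) :
    ‖Complex.exp (x * Complex.I) - (1 + x * Complex.I - x ^ 2 / 2)‖ ≤ 4 * |x| ^ 3 := by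
  have hnorm : ‖(x : ℂ) * Complex.I‖ = |x| := by simp
  rcases le_total |x| 1 with hx | hx
  · have h := Complex.exp_bound (x := x * Complex.I) (by rw [hnorm]; exact hx) (n := 3) (by norm_num)
    have hsum : ∑ m ∈ Finset.range 3, ((x : ℂ) * Complex.I) ^ m / (m.factorial : ℂ)
        = 1 + x * Complex.I - x ^ 2 / 2 := by
      simp [Finset.sum_range_succ, mul_pow, Nat.factorial]
      ring
    rw [hsum, hnorm] at h
    refine h.trans ?_
    have : (0 : ℝ) ≤ |x| ^ 3 := by positivity
    norm_num [Nat.factorial]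
    linarith
  · have h1 : ‖(1 : ℂ) + x * Complex.I - x ^ 2 / 2‖ ≤ 1 + |x| + |x| ^ 2 / 2 := by
      refine (norm_sub_le _ _).trans (add_le_add ((norm_add_le _ _).trans ?_) ?_)
      · simp
      · simp
    have h2 : ‖Complex.exp (x * Complex.I)‖ = 1 := Complex.norm_exp_ofReal_mul_I x
    refine (norm_sub_le _ _).trans ?_
    rw [h2]
    have h3 : |x| ≤ |x| ^ 3 := le_self_pow₀ hx (by norm_num)
    have h4 : |x| ^ 2 ≤ |x| ^ 3 := pow_le_pow_right₀ hx (by norm_num)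
    linarith

/-- The Gaussian characteristic function obeys the same cubic Taylor bound. -/
lemma abs_exp_neg_sq_div_two_sub_le {w : ℝ} (hw : 0 ≤ w) :
    |Real.exp (-(w ^ 2 / 2)) - (1 - w ^ 2 / 2)| ≤ w ^ 3 := by
  rcases le_total w 1 with h | h
  · have hsq : w ^ 2 ≤ 1 := pow_le_one₀ hw h
    have h1 := Real.abs_exp_sub_one_sub_id_le (x := -(w ^ 2 / 2))
      (by rw [abs_neg, abs_of_nonneg (by positivity)]; linarith)
    have h2 : w ^ 4 ≤ w ^ 3 := pow_le_pow_of_le_one hw h (by norm_num)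
    calc |Real.exp (-(w ^ 2 / 2)) - (1 - w ^ 2 / 2)|
        = |Real.exp (-(w ^ 2 / 2)) - 1 - -(w ^ 2 / 2)| := by ring_nf
      _ ≤ (-(w ^ 2 / 2)) ^ 2 := h1
      _ = w ^ 4 / 4 := by ring
      _ ≤ w ^ 3 := by nlinarith [pow_nonneg hw 4]
  · have h1 : Real.exp (-(w ^ 2 / 2)) ≤ 1 := Real.exp_le_one_iff.2 (by nlinarith [sq_nonneg w])
    have h2 := Real.add_one_le_exp (-(w ^ 2 / 2))
    have h3 : w ^ 2 ≤ w ^ 3 := pow_le_pow_right₀ h (by norm_num)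
    rw [abs_of_nonneg (by linarith)]
    nlinarith [sq_nonneg w]

lemma norm_prod_sub_prod_le_sum {ι : Type*} (s : Finset ι) (a b : ι → ℂ)
    (ha : ∀ i ∈ s, ‖a i‖ ≤ 1) (hb : ∀ i ∈ s, ‖b i‖ ≤ 1) :
    ‖∏ i ∈ s, a i - ∏ i ∈ s, b i‖ ≤ ∑ i ∈ s, ‖a i - b i‖ := by
  classical
  induction s using Finset.induction with
  | empty => simp
  | insert i s hi ih =>
    rw [Finset.prod_insert hi, Finset.prod_insert hi, Finset.sum_insert hi]
    have hA : ‖∏ j ∈ s, a j‖ ≤ 1 := (Finset.norm_prod_le _ _).trans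
      (Finset.prod_le_one (fun _ _ => norm_nonneg _)
        fun j hj => ha j (Finset.mem_insert_of_mem hj))
    have hB := ih (fun j hj => ha j (Finset.mem_insert_of_mem hj))
      (fun j hj => hb j (Finset.mem_insert_of_mem hj))
    have hbi := hb i (Finset.mem_insert_self i s)
    calc ‖a i * ∏ j ∈ s, a j - b i * ∏ j ∈ s, b j‖
        = ‖(a i - b i) * ∏ j ∈ s, a j + b i * (∏ j ∈ s, a j - ∏ j ∈ s, b j)‖ := by ring_nf
      _ ≤ ‖a i - b i‖ * ‖∏ j ∈ s, a j‖ + ‖b i‖ * ‖∏ j ∈ s, a j - ∏ j ∈ s, b j‖ := by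
          refine (norm_add_le _ _).trans ?_
          rw [norm_mul, norm_mul]
      _ ≤ ‖a i - b i‖ * 1 + 1 * ∑ j ∈ s, ‖a j - b j‖ := by gcongr
      _ = _ := by ring

/-! ### The Lyapunov central limit theorem -/

section Lyapunov

variable {Ω : Type*} [MeasurableSpace Ω] {μ : Measure Ω}

lemma integrable_abs_pow_of_memLp_three {X : Ω → ℝ} (hX : MemLp X 3 μ) :
    Integrable (fun ω => |X ω| ^ 3) μ := by
  have h : MemLp X (3 : ℕ) μ := by rwa [Nat.cast_ofNat]
  exact h.integrable_norm_pow three_ne_zero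

variable [IsProbabilityMeasure μ]

/-- Lyapunov's moment inequality `(E X²)^(1/2) ≤ (E |X|³)^(1/3)`, cubed. -/
lemma sqrt_integral_sq_pow_three_le {X : Ω → ℝ} (hX : MemLp X 3 μ) :
    √(∫ ω, X ω ^ 2 ∂μ) ^ 3 ≤ ∫ ω, |X ω| ^ 3 ∂μ := by
  set a := √(∫ ω, X ω ^ 2 ∂μ) with ha
  have ha0 : 0 ≤ a := Real.sqrt_nonneg _
  have hsq : ∫ ω, X ω ^ 2 ∂μ = a ^ 2 :=
    (Real.sq_sqrt (integral_nonneg fun _ => sq_nonneg _)).symm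
  have h2 : Integrable (fun ω => X ω ^ 2) μ :=
    (hX.mono_exponent (by norm_num : (2 : ENNReal) ≤ 3)).integrable_sq
  -- Integrate the tangent inequality `y³ ≥ (3/2) a y² - a³/2` at `y = |X|`.
  have key : ∫ ω, (3 / 2 * a * X ω ^ 2 - a ^ 3 / 2) ∂μ ≤ ∫ ω, |X ω| ^ 3 ∂μ := by
    refine integral_mono ((h2.const_mul _).sub (integrable_const _))
      (integrable_abs_pow_of_memLp_three hX) fun ω => ?_
    have hy := abs_nonneg (X ω)
    have := mul_nonneg (sq_nonneg (|X ω| - a)) (by positivity : 0 ≤ 2 * |X ω| + a)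
    simp only [← sq_abs (X ω)]
    nlinarith
  rw [integral_sub (h2.const_mul _) (integrable_const _), integral_const_mul, hsq] at key
  simp only [integral_const, probReal_univ, smul_eq_mul, one_mul] at key
  nlinarith

lemma norm_charFun_map_sub_taylor_two_le {X : Ω → ℝ} (hX : MemLp X 3 μ) (h0 : ∫ ω, X ω ∂μ = 0)
    (t : ℝ) :
    ‖charFun (μ.map X) t - (1 - ((t ^ 2 * ∫ ω, X ω ^ 2 ∂μ : ℝ) : ℂ) / 2)‖
      ≤ 4 * |t| ^ 3 * ∫ ω, |X ω| ^ 3 ∂μ := by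
  have h1 : Integrable X μ := hX.integrable (by norm_num)
  have h2 : Integrable (fun ω => X ω ^ 2) μ :=
    (hX.mono_exponent (by norm_num : (2 : ENNReal) ≤ 3)).integrable_sq
  have hXm := hX.aestronglyMeasurable.aemeasurable
  have hchar : charFun (μ.map X) t = ∫ ω, Complex.exp ((t * X ω : ℝ) * Complex.I) ∂μ := by
    rw [charFun_apply_real, integral_map hXm (by fun_prop)]
    simp
  have hi1 : Integrable (fun ω => (1 : ℂ) + (t * X ω : ℝ) * Complex.I) μ :=
    (integrable_const _).add (((h1.const_mul t).ofReal).mul_const _)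
  have hi2 : Integrable (fun ω => (((t * X ω : ℝ) : ℂ)) ^ 2 / 2) μ := by
    have : Integrable (fun ω => ((t ^ 2 * X ω ^ 2 / 2 : ℝ) : ℂ)) μ :=
      ((h2.const_mul _).div_const 2).ofReal
    refine this.congr (ae_of_all _ fun ω => ?_)
    push_cast; ring
  have hpoly : (1 - ((t ^ 2 * ∫ ω, X ω ^ 2 ∂μ : ℝ) : ℂ) / 2) =
      ∫ ω, (1 + (t * X ω : ℝ) * Complex.I - ((t * X ω : ℝ) : ℂ) ^ 2 / 2) ∂μ := by
    rw [integral_sub hi1 hi2, integral_add (integrable_const _)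
      (((h1.const_mul t).ofReal).mul_const _), integral_mul_const, integral_div]
    have e1 : ∫ ω, ((t * X ω : ℝ) : ℂ) ∂μ = 0 := by
      rw [integral_complex_ofReal, integral_const_mul, h0]; simp
    have e2 : ∫ ω, ((t * X ω : ℝ) : ℂ) ^ 2 ∂μ = ((t ^ 2 * ∫ ω, X ω ^ 2 ∂μ : ℝ) : ℂ) := by
      rw [← integral_const_mul, ← integral_complex_ofReal]
      congr 1; ext ω; push_cast; ring
    rw [e1, e2]; simp
  have hexp : Integrable (fun ω => Complex.exp ((t * X ω : ℝ) * Complex.I)) μ := by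
    refine Integrable.of_bound (C := 1) (by fun_prop) (ae_of_all _ fun ω => ?_)
    rw [Complex.norm_exp_ofReal_mul_I]
  have hsub := integral_sub hexp (hi1.sub hi2)
  simp only [Pi.sub_apply] at hsub
  rw [hchar, hpoly, ← hsub]
  refine (norm_integral_le_integral_norm _).trans ?_
  rw [← integral_const_mul]
  refine integral_mono_of_nonneg (ae_of_all _ fun _ => norm_nonneg _)
    ((integrable_abs_pow_of_memLp_three hX).const_mul _) (ae_of_all _ fun ω => ?_)
  refine (norm_exp_mul_I_sub_taylor_two_le (t * X ω)).trans_eq ?_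
  rw [abs_mul]; ring

/-- A centred variable is close in characteristic function to the Gaussian of equal variance. -/
lemma norm_charFun_map_sub_gaussian_le {X : Ω → ℝ} (hX : MemLp X 3 μ) (h0 : ∫ ω, X ω ∂μ = 0)
    (t : ℝ) :
    ‖charFun (μ.map X) t - Complex.exp ((-(t ^ 2 * ∫ ω, X ω ^ 2 ∂μ) / 2 : ℝ) : ℂ)‖
      ≤ 5 * |t| ^ 3 * ∫ ω, |X ω| ^ 3 ∂μ := by
  set v := ∫ ω, X ω ^ 2 ∂μ with hv
  have hv0 : 0 ≤ v := integral_nonneg fun _ => sq_nonneg _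
  have h1 := norm_charFun_map_sub_taylor_two_le hX h0 t
  have h2 := abs_exp_neg_sq_div_two_sub_le (w := |t| * √v) (by positivity)
  have h3 := sqrt_integral_sq_pow_three_le hX
  have hw : (|t| * √v) ^ 2 = t ^ 2 * v := by rw [mul_pow, sq_abs, Real.sq_sqrt hv0]
  rw [hw, mul_pow] at h2
  have h4 : ‖(1 - ((t ^ 2 * v : ℝ) : ℂ) / 2) - Complex.exp ((-(t ^ 2 * v) / 2 : ℝ) : ℂ)‖
      ≤ |t| ^ 3 * ∫ ω, |X ω| ^ 3 ∂μ := by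
    have : (1 - ((t ^ 2 * v : ℝ) : ℂ) / 2) - Complex.exp ((-(t ^ 2 * v) / 2 : ℝ) : ℂ)
        = ((-(Real.exp (-(t ^ 2 * v / 2)) - (1 - t ^ 2 * v / 2)) : ℝ) : ℂ) := by
      push_cast
      rw [neg_div]
      ring
    rw [this, Complex.norm_real, Real.norm_eq_abs, abs_neg]
    exact h2.trans (by gcongr)
  have h5 := norm_sub_le_norm_sub_add_norm_sub (charFun (μ.map X) t)
    (1 - ((t ^ 2 * v : ℝ) : ℂ) / 2) (Complex.exp ((-(t ^ 2 * v) / 2 : ℝ) : ℂ))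
  linarith

/-- **Lyapunov's central limit theorem** for centred independent variables under the third-moment
condition, as pointwise convergence of characteristic functions. -/
theorem tendsto_charFun_of_lyapunov {X : ℕ → Ω → ℝ} (hX : ∀ j, MemLp (X j) 3 μ)
    (h0 : ∀ j, ∫ ω, X j ω ∂μ = 0) (hindep : iIndepFun X μ) {s : ℕ → ℝ}
    (hs : ∀ᶠ n in atTop, 0 < s n)
    (hvar : ∀ n, s n ^ 2 = ∑ j ∈ Finset.range n, ∫ ω, X j ω ^ 2 ∂μ)
    (hlyap : Tendsto (fun n => (∑ j ∈ Finset.range n, ∫ ω, |X j ω| ^ 3 ∂μ) / s n ^ 3)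
      atTop (𝓝 0)) (t : ℝ) :
    Tendsto (fun n => charFun (μ.map fun ω => (s n)⁻¹ * ∑ j ∈ Finset.range n, X j ω) t)
      atTop (𝓝 (charFun (gaussianReal 0 1) t)) := by
  have hm j : AEMeasurable (X j) μ := (hX j).aestronglyMeasurable.aemeasurable
  rw [tendsto_iff_norm_sub_tendsto_zero]
  have hlim : Tendsto (fun n => 5 * |t| ^ 3 *
      ((∑ j ∈ Finset.range n, ∫ ω, |X j ω| ^ 3 ∂μ) / s n ^ 3)) atTop (𝓝 0) := by
    simpa using hlyap.const_mul (5 * |t| ^ 3)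
  refine squeeze_zero' (Eventually.of_forall fun _ => norm_nonneg _) ?_ hlim
  filter_upwards [hs] with n hn
  rw [charFun_map_mul_comp (Finset.aemeasurable_fun_sum _ fun j _ => hm j),
    (hindep.restrict _).charFun_map_fun_finsetSum_eq_prod (fun j _ => hm j), Finset.prod_apply]
  set u := (s n)⁻¹ * t with hu
  have hgauss : charFun (gaussianReal 0 1) t = ∏ j ∈ Finset.range n,
      Complex.exp ((-(u ^ 2 * ∫ ω, X j ω ^ 2 ∂μ) / 2 : ℝ) : ℂ) := by
    rw [charFun_gaussianReal, ← Complex.exp_sum, ← Complex.ofReal_sum, ← Finset.sum_div,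
      Finset.sum_neg_distrib, ← Finset.mul_sum, ← hvar n]
    have : u ^ 2 * s n ^ 2 = t ^ 2 := by rw [hu]; field_simp
    rw [this]
    simp [neg_div]
  rw [hgauss]
  refine (norm_prod_sub_prod_le_sum _ _ _ ?_ ?_).trans ?_
  · intro j _
    have := Measure.isProbabilityMeasure_map (hm j)
    exact norm_charFun_le_one _
  · intro j _
    rw [Complex.norm_exp, Complex.ofReal_re]
    refine Real.exp_le_one_iff.2 ?_
    have : 0 ≤ ∫ ω, X j ω ^ 2 ∂μ := integral_nonneg fun _ => sq_nonneg _
    have : 0 ≤ u ^ 2 * ∫ ω, X j ω ^ 2 ∂μ := by positivity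
    linarith
  · refine (Finset.sum_le_sum fun j _ =>
      norm_charFun_map_sub_gaussian_le (hX j) (h0 j) u).trans_eq ?_
    rw [← Finset.mul_sum, hu, abs_mul, abs_of_pos (inv_pos.2 hn)]
    field_simp

end Lyapunov

/-! ### The standard normal distribution function -/

lemma measure_singleton_stdGaussian (x : ℝ) : gaussianReal 0 1 {x} = 0 :=
  gaussianReal_absolutelyContinuous 0 one_ne_zero (by simp)

lemma continuous_stdNormalCDF : Continuous stdNormalCDF := by
  rw [continuous_iff_continuousAt]
  intro x
  have hmono : Monotone stdNormalCDF := monotone_cdf (gaussianReal 0 1)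
  have h0 := (cdf (gaussianReal 0 1)).measure_singleton x
  rw [measure_cdf, measure_singleton_stdGaussian, eq_comm, ENNReal.ofReal_eq_zero] at h0
  have hleft : Function.leftLim stdNormalCDF x = stdNormalCDF x :=
    le_antisymm (hmono.leftLim_le le_rfl) (sub_nonpos.1 h0)
  refine continuousAt_iff_continuous_left'_right'.2
    ⟨hmono.continuousWithinAt_Iio_iff_leftLim_eq.2 hleft, ?_⟩
  exact ((cdf (gaussianReal 0 1)).right_continuous x).mono Set.Ioi_subset_Ici_self

lemma strictMono_stdNormalCDF : StrictMono stdNormalCDF := by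
  intro a b hab
  by_contra! h
  have h0 : gaussianReal 0 1 (Set.Ioc a b) = 0 := by
    rw [← measure_cdf (gaussianReal 0 1), StieltjesFunction.measure_Ioc, ENNReal.ofReal_eq_zero]
    exact sub_nonpos.2 h
  have := gaussianReal_absolutelyContinuous' 0 one_ne_zero h0
  rw [Real.volume_Ioc, ENNReal.ofReal_eq_zero] at this
  linarith

lemma stdNormalCDF_stdNormalCDFInv {p : ℝ} (h0 : 0 < p) (h1 : p < 1) :
    stdNormalCDF (stdNormalCDFInv p) = p := by
  refine Function.invFun_eq (mem_range_of_exists_le_of_exists_ge continuous_stdNormalCDF ?_ ?_)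
  · exact ((tendsto_cdf_atBot (gaussianReal 0 1)).eventually_le_const h0).exists
  · exact ((tendsto_cdf_atTop (gaussianReal 0 1)).eventually_const_le h1).exists

lemma measureReal_Ioi_stdGaussian (x : ℝ) :
    (gaussianReal 0 1).real (Set.Ioi x) = 1 - stdNormalCDF x := by
  rw [stdNormalCDF, cdf_eq_real, ← probReal_compl_eq_one_sub measurableSet_Iic, Set.compl_Iic]

lemma one_sub_stdNormalCDF_neg (x : ℝ) : 1 - stdNormalCDF (-x) = stdNormalCDF x := by
  have hmap : (gaussianReal 0 1).map (fun y => -y) = gaussianReal 0 1 := by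
    rw [gaussianReal_map_neg, neg_zero]
  have hIci : (gaussianReal 0 1).real (Set.Ici x) = stdNormalCDF (-x) := by
    rw [stdNormalCDF, cdf_eq_real, ← hmap,
      map_measureReal_apply measurable_neg measurableSet_Iic, hmap]
    congr 1; ext y; simp
  have hae : Set.Ioi x =ᵐ[gaussianReal 0 1] Set.Ici x :=
    Ioi_ae_eq_Ici' (measure_singleton_stdGaussian x)
  have := measureReal_Ioi_stdGaussian x
  rw [measureReal_congr hae, hIci] at this
  linarith

/-! ### Privacy curves and tail probabilities -/

section PrivacyCurve

variable {Ω : Type*} [MeasurableSpace Ω] {μ : Measure Ω} [IsProbabilityMeasure μ]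

lemma integrable_privacyCurve_integrand {X : Ω → ℝ} (hX : Measurable X) (ε : ℝ) :
    Integrable (fun ω => max 0 (1 - Real.exp (-(X ω - ε)))) μ := by
  refine Integrable.of_bound (C := 1) (by fun_prop) (ae_of_all _ fun ω => ?_)
  rw [Real.norm_eq_abs, abs_of_nonneg (le_max_left _ _)]
  exact max_le zero_le_one (by linarith [Real.exp_pos (-(X ω - ε))])

lemma antitone_privacyCurve {X : Ω → ℝ} (hX : Measurable X) : Antitone (privacyCurve μ X) := by
  intro a b hab
  refine integral_mono (integrable_privacyCurve_integrand hX b)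
    (integrable_privacyCurve_integrand hX a) fun ω => ?_
  simp only
  gcongr

lemma privacyCurve_le_measureReal {X : Ω → ℝ} (hX : Measurable X) (ε : ℝ) :
    privacyCurve μ X ε ≤ μ.real {ω | ε < X ω} := by
  have hS : MeasurableSet {ω | ε < X ω} := measurableSet_lt measurable_const hX
  rw [← integral_indicator_one hS]
  refine integral_mono (integrable_privacyCurve_integrand hX ε)
    ((integrable_indicator_iff hS).2 (integrable_const _).integrableOn) fun ω => ?_
  by_cases h : ε < X ω
  · rw [Set.indicator_of_mem (show ω ∈ {ω | ε < X ω} from h), Pi.one_apply]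
    exact max_le zero_le_one (by linarith [Real.exp_pos (-(X ω - ε))])
  · rw [Set.indicator_of_notMem (show ω ∉ {ω | ε < X ω} from h)]
    exact max_le le_rfl (by linarith [Real.one_le_exp (by linarith : 0 ≤ -(X ω - ε))])

lemma mul_measureReal_le_privacyCurve {X : Ω → ℝ} (hX : Measurable X) (ε h : ℝ) :
    (1 - Real.exp (-h)) * μ.real {ω | ε + h < X ω} ≤ privacyCurve μ X ε := by
  have hS : MeasurableSet {ω | ε + h < X ω} := measurableSet_lt measurable_const hX
  rw [← integral_indicator_one hS, ← integral_const_mul]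
  refine integral_mono (((integrable_indicator_iff hS).2
    (integrable_const _).integrableOn).const_mul _)
    (integrable_privacyCurve_integrand hX ε) fun ω => ?_
  by_cases h' : ε + h < X ω
  · simp only [Set.indicator_of_mem (show ω ∈ {ω | ε + h < X ω} from h'), Pi.one_apply, mul_one]
    refine le_max_of_le_right ?_
    gcongr
    linarith
  · simp [Set.indicator_of_notMem (show ω ∉ {ω | ε + h < X ω} from h')]

/-- If `(X n - m n) / s n` converges in law to a standard normal and `s n → ∞`, then on the scale
`s n` the kernel `(1 - exp (-·))⁺` of the privacy curve degenerates to the indicator of a half-line,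
so the privacy curve has the same limit as the tail probability. -/
lemma tendsto_privacyCurve_of_tendsto_tail {X : ℕ → Ω → ℝ} (hX : ∀ n, Measurable (X n))
    {m s : ℕ → ℝ} (hs : Tendsto s atTop atTop)
    (htail : ∀ x, Tendsto (fun n => μ.real {ω | m n + x * s n < X n ω}) atTop
      (𝓝 (1 - stdNormalCDF x))) (x : ℝ) :
    Tendsto (fun n => privacyCurve μ (X n) (m n + x * s n)) atTop (𝓝 (1 - stdNormalCDF x)) := by
  refine tendsto_order.2 ⟨fun a ha => ?_, fun a ha => ?_⟩
  · -- Choose a slightly larger threshold `y > x` whose Gaussian tail still exceeds `a`.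
    obtain ⟨y, hay, hxy⟩ : ∃ y, a < 1 - stdNormalCDF y ∧ x < y := by
      have hc : Tendsto (fun y => 1 - stdNormalCDF y) (𝓝[>] x) (𝓝 (1 - stdNormalCDF x)) :=
        ((continuous_const.sub continuous_stdNormalCDF).tendsto x).mono_left nhdsWithin_le_nhds
      exact ((hc.eventually_const_lt ha).and self_mem_nhdsWithin).exists
    have hexp : Tendsto (fun n => 1 - Real.exp (-((y - x) * s n))) atTop (𝓝 (1 - 0)) :=
      tendsto_const_nhds.sub (Real.tendsto_exp_neg_atTop_nhds_zero.comp
        (hs.const_mul_atTop (sub_pos.2 hxy)))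
    have hprod := hexp.mul (htail y)
    rw [sub_zero, one_mul] at hprod
    filter_upwards [hprod.eventually_const_lt hay] with n hn
    refine hn.trans_le ?_
    have := mul_measureReal_le_privacyCurve (μ := μ) (hX n) (m n + x * s n) ((y - x) * s n)
    rwa [show m n + x * s n + (y - x) * s n = m n + y * s n by ring] at this
  · filter_upwards [(htail x).eventually_lt_const ha] with n hn
    exact (privacyCurve_le_measureReal (hX n) _).trans_lt hn

/-- Convergence of the privacy curves, rescaled by `m n` and `s n`, to a strictly decreasing limit
passes to their inverses. The bound `hm` keeps the constraint `0 ≤ ε` inactive. -/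
lemma tendsto_privacyCurveInv_of_tendsto {X : ℕ → Ω → ℝ} (hX : ∀ n, Measurable (X n))
    {m s : ℕ → ℝ} (hs : ∀ᶠ n in atTop, 0 < s n) (hm : ∀ c, ∀ᶠ n in atTop, 0 ≤ m n + c * s n)
    {G : ℝ → ℝ} (hG : StrictAnti G)
    (hcurve : ∀ x, Tendsto (fun n => privacyCurve μ (X n) (m n + x * s n)) atTop (𝓝 (G x)))
    (x : ℝ) :
    Tendsto (fun n => (privacyCurveInv μ (X n) (G x) - m n) / s n) atTop (𝓝 x) := by
  have hmem : ∀ b, x < b → ∀ᶠ n in atTop,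
      m n + b * s n ∈ {ε : ℝ | 0 ≤ ε ∧ privacyCurve μ (X n) ε ≤ G x} := fun b hb => by
    filter_upwards [hm b, (hcurve b).eventually_le_const (hG hb)] with n h1 h2 using ⟨h1, h2⟩
  refine tendsto_order.2 ⟨fun a ha => ?_, fun a ha => ?_⟩
  · obtain ⟨b, hab, hbx⟩ := exists_between ha
    filter_upwards [hs, (hcurve b).eventually_const_lt (hG hbx), hmem (x + 1) (by linarith)]
      with n hn hlt hne
    rw [lt_div_iff₀ hn]
    have : m n + b * s n ≤ privacyCurveInv μ (X n) (G x) := by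
      refine le_csInf ⟨_, hne⟩ fun ε hε => ?_
      by_contra! hlt'
      exact absurd ((antitone_privacyCurve (hX n) hlt'.le).trans hε.2) (not_le.2 hlt)
    nlinarith
  · obtain ⟨b, hxb, hba⟩ := exists_between ha
    filter_upwards [hs, hmem b hxb] with n hn hb
    rw [div_lt_iff₀ hn]
    have : privacyCurveInv μ (X n) (G x) ≤ m n + b * s n := csInf_le ⟨0, fun _ h => h.1⟩ hb
    nlinarith

end PrivacyCurve

/-! ### The untilted moments -/

section Moments

variable {Ω : Type*} [MeasurableSpace Ω] {μ : Measure Ω} [IsProbabilityMeasure μ]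

lemma tiltedLaw_zero {X : Ω → ℝ} (hX : Measurable X) : tiltedLaw μ X 0 = μ.map X := by
  have := Measure.isProbabilityMeasure_map (μ := μ) hX.aemeasurable
  simp [tiltedLaw]

lemma tiltedMean_zero {X : Ω → ℝ} (hX : Measurable X) : tiltedMean μ X 0 = ∫ ω, X ω ∂μ := by
  rw [tiltedMean, tiltedLaw_zero hX, integral_map hX.aemeasurable (by fun_prop)]

lemma tiltedVariance_zero {X : Ω → ℝ} (hX : Measurable X) :
    tiltedVariance μ X 0 = variance X μ := by
  rw [tiltedVariance, tiltedLaw_zero hX, integral_map hX.aemeasurable (by fun_prop),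
    tiltedMean_zero hX, variance_eq_integral hX.aemeasurable]

lemma tiltedThirdAbsMoment_zero {X : Ω → ℝ} (hX : Measurable X) :
    tiltedThirdAbsMoment μ X 0 = ∫ ω, |X ω - ∫ ω', X ω' ∂μ| ^ 3 ∂μ := by
  rw [tiltedThirdAbsMoment, tiltedLaw_zero hX, integral_map hX.aemeasurable (by fun_prop),
    tiltedMean_zero hX]

lemma TiltFinite.memLp_three {X : Ω → ℝ} (hX : Measurable X) (h : TiltFinite μ X 0) :
    MemLp X 3 μ := by
  have h2 := h.2
  rw [tiltedLaw_zero hX, integrable_map_measure (by fun_prop) hX.aemeasurable] at h2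
  refine (integrable_norm_rpow_iff hX.aestronglyMeasurable (by norm_num) (by norm_num)).1
    (h2.congr (ae_of_all _ fun ω => ?_))
  simp only [Function.comp_apply, ENNReal.toReal_ofNat, Real.norm_eq_abs]
  norm_cast

/-! ### Partial sums -/

lemma measurable_partialSum {L : ℕ → Ω → ℝ} (hL : ∀ j, Measurable (L j)) (n : ℕ) :
    Measurable (partialSum L n) :=
  Finset.measurable_fun_sum _ fun j _ => hL j

lemma meanOf_partialSum {L : ℕ → Ω → ℝ} (hL : ∀ j, MemLp (L j) 3 μ) (n : ℕ) :
    meanOf μ (partialSum L n) = ∑ j ∈ Finset.range n, ∫ ω, L j ω ∂μ :=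
  integral_finsetSum _ fun j _ => (hL j).integrable (by norm_num)

lemma variance_partialSum {L : ℕ → Ω → ℝ} (hL : ∀ j, MemLp (L j) 3 μ) (hindep : iIndepFun L μ)
    (n : ℕ) :
    variance (partialSum L n) μ = ∑ j ∈ Finset.range n, variance (L j) μ := by
  have h : partialSum L n = ∑ j ∈ Finset.range n, L j := by
    ext ω; simp [partialSum]
  rw [h, IndepFun.variance_sum (fun j _ => (hL j).mono_exponent (by norm_num))
    fun i _ j _ hij => hindep.indepFun hij]

/-- Lyapunov's central limit theorem for the partial sums, as convergence of tail probabilities. -/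
lemma tendsto_tail_partialSum {L : ℕ → Ω → ℝ} (hmeas : ∀ j, Measurable (L j))
    (hL : ∀ j, MemLp (L j) 3 μ) (hindep : iIndepFun L μ)
    (hs : ∀ᶠ n in atTop, 0 < stdDev μ (partialSum L n))
    (hlyap : Tendsto (fun n => (∑ j ∈ Finset.range n, ∫ ω, |L j ω - ∫ ω', L j ω' ∂μ| ^ 3 ∂μ) /
      stdDev μ (partialSum L n) ^ 3) atTop (𝓝 0)) (x : ℝ) :
    Tendsto (fun n => μ.real {ω | meanOf μ (partialSum L n) + x * stdDev μ (partialSum L n)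
      < partialSum L n ω}) atTop (𝓝 (1 - stdNormalCDF x)) := by
  set s : ℕ → ℝ := fun n => stdDev μ (partialSum L n) with hs_def
  set X : ℕ → Ω → ℝ := fun j ω => L j ω - ∫ ω', L j ω' ∂μ with hX_def
  have hXm j : Measurable (X j) := (hmeas j).sub_const _
  have hX j : MemLp (X j) 3 μ := (hL j).sub (memLp_const _)
  have hX0 j : ∫ ω, X j ω ∂μ = 0 := by
    rw [hX_def, integral_sub ((hL j).integrable (by norm_num)) (integrable_const _)]
    simp
  have hXi : iIndepFun X μ :=
    hindep.comp (fun j y => y - ∫ ω', L j ω' ∂μ) fun j => measurable_id.sub_const _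
  have hvar n : s n ^ 2 = ∑ j ∈ Finset.range n, ∫ ω, X j ω ^ 2 ∂μ := by
    simp only [hs_def, stdDev]
    rw [Real.sq_sqrt (variance_nonneg _ _), variance_partialSum hL hindep]
    exact Finset.sum_congr rfl fun j _ => variance_eq_integral (hmeas j).aemeasurable
  have hZm n : Measurable fun ω => (s n)⁻¹ * ∑ j ∈ Finset.range n, X j ω :=
    (Finset.measurable_fun_sum _ fun j _ => hXm j).const_mul _
  let ν : ℕ → ProbabilityMeasure ℝ := fun n =>
    ⟨μ.map fun ω => (s n)⁻¹ * ∑ j ∈ Finset.range n, X j ω,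
      Measure.isProbabilityMeasure_map (hZm n).aemeasurable⟩
  let γ : ProbabilityMeasure ℝ := ⟨gaussianReal 0 1, inferInstance⟩
  have hν : Tendsto ν atTop (𝓝 γ) := ProbabilityMeasure.tendsto_iff_tendsto_charFun.2 fun t =>
    tendsto_charFun_of_lyapunov hX hX0 hXi hs hvar hlyap t
  have hIoi := ProbabilityMeasure.tendsto_measure_of_null_frontier_of_tendsto' hν
    (E := Set.Ioi x) (by rw [frontier_Ioi]; exact measure_singleton_stdGaussian x)
  have hreal := (ENNReal.tendsto_toReal (measure_ne_top _ _)).comp hIoi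
  have hlim : ((γ : Measure ℝ) (Set.Ioi x)).toReal = 1 - stdNormalCDF x :=
    measureReal_Ioi_stdGaussian x
  rw [hlim] at hreal
  refine hreal.congr' ?_
  filter_upwards [hs] with n hn
  change (μ.map fun ω => (s n)⁻¹ * ∑ j ∈ Finset.range n, X j ω).real (Set.Ioi x) = _
  rw [map_measureReal_apply (hZm n) measurableSet_Ioi]
  congr 1
  ext ω
  simp only [Set.mem_preimage, Set.mem_Ioi, Set.mem_ofPred_eq, meanOf_partialSum hL, hX_def,
    Finset.sum_sub_distrib, partialSum]
  rw [inv_mul_eq_div, lt_div_iff₀ hn, lt_sub_iff_add_lt']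

end Moments

/-! ### Limits of the privacy curve and of its inverse -/

theorem theorem4p4 {Ω : Type*} [MeasurableSpace Ω] (μ : Measure Ω) [IsProbabilityMeasure μ]
    (L : ℕ → Ω → ℝ) (hmeas : ∀ j, Measurable (L j)) (hindep : iIndepFun L μ)
    (hmom : MomentAssumption μ L) (δ : ℝ) (hδ0 : 0 < δ) (hδ1 : δ < 1 / 2) :
    Tendsto
      (fun n : ℕ => privacyCurve μ (partialSum L n)
        (meanOf μ (partialSum L n) - stdNormalCDFInv δ * stdDev μ (partialSum L n)))
      atTop (𝓝 δ) ∧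
    Tendsto
      (fun n : ℕ => (privacyCurveInv μ (partialSum L n) δ - meanOf μ (partialSum L n))
        / stdDev μ (partialSum L n))
      atTop (𝓝 (-stdNormalCDFInv δ)) := by
  obtain ⟨KL, V, P, hKL, hV, h⟩ := hmom
  -- The central limit theorem concerns the untilted sum, so the zero sequence of tilts is used.
  obtain ⟨hfin, hmean, hvar, hthird⟩ := h (fun _ => 0) (fun _ => le_rfl) (isLittleO_zero _ _)
  have hSm := measurable_partialSum hmeas
  have hL3 : ∀ j, MemLp (L j) 3 μ := fun j => by
    obtain ⟨n, hn, hj⟩ := (hfin.and (eventually_gt_atTop j)).exists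
    exact (hn j hj).memLp_three (hmeas j)
  set m : ℕ → ℝ := fun n => meanOf μ (partialSum L n) with hm_def
  set s : ℕ → ℝ := fun n => stdDev μ (partialSum L n) with hs_def
  have hmean' : Tendsto (fun n : ℕ => m n / n) atTop (𝓝 KL) :=
    hmean.congr fun n => by rw [tiltedMean_zero (hSm n)]; rfl
  have hvar' : Tendsto (fun n : ℕ => s n ^ 2 / n) atTop (𝓝 V) := hvar.congr fun n => by
    simp only [hs_def, stdDev]
    rw [tiltedVariance_zero (hSm n), Real.sq_sqrt (variance_nonneg _ _)]
  have hs0 n : 0 ≤ s n := Real.sqrt_nonneg _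
  have hn : Tendsto (fun n : ℕ => (n : ℝ)) atTop atTop := tendsto_natCast_atTop_atTop
  have hs2 : Tendsto (fun n => s n ^ 2) atTop atTop := by
    refine (hvar'.pos_mul_atTop hV hn).congr' ?_
    filter_upwards [eventually_gt_atTop 0] with n hn0
    field_simp
  have hs : Tendsto s atTop atTop :=
    (Real.tendsto_sqrt_atTop.comp hs2).congr fun n => Real.sqrt_sq (hs0 n)
  have hspos : ∀ᶠ n in atTop, 0 < s n := hs.eventually_gt_atTop 0
  have hlyap : Tendsto (fun n => (∑ j ∈ Finset.range n, ∫ ω, |L j ω - ∫ ω', L j ω' ∂μ| ^ 3 ∂μ) /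
      s n ^ 3) atTop (𝓝 0) := by
    refine (hthird.div_atTop (hvar'.pos_mul_atTop hV hs)).congr' ?_
    filter_upwards [eventually_gt_atTop 0, hspos] with n hn0 hsn
    simp only [tiltedThirdAbsMoment_zero (hmeas _)]
    field_simp
  have hcurve : ∀ x, Tendsto (fun n => privacyCurve μ (partialSum L n) (m n + x * s n)) atTop
      (𝓝 (1 - stdNormalCDF x)) :=
    tendsto_privacyCurve_of_tendsto_tail hSm hs
      (tendsto_tail_partialSum hmeas hL3 hindep hspos hlyap)
  have hδ : 1 - stdNormalCDF (-stdNormalCDFInv δ) = δ := by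
    rw [one_sub_stdNormalCDF_neg, stdNormalCDF_stdNormalCDFInv hδ0 (by linarith)]
  -- The mean grows like `n` and the deviation only like `√n`, so every threshold is eventually
  -- nonnegative.
  have hnonneg : ∀ c, ∀ᶠ n in atTop, 0 ≤ m n + c * s n := fun c => by
    have hsn : Tendsto (fun n : ℕ => s n / n) atTop (𝓝 0) := by
      refine (hvar'.div_atTop hs).congr' ?_
      filter_upwards [hspos] with n hsn
      field_simp
    have hsum := hmean'.add (hsn.const_mul c)
    rw [mul_zero, add_zero] at hsum
    filter_upwards [hsum.eventually_const_lt hKL, eventually_gt_atTop 0] with n h1 hn0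
    have hn0' : (0 : ℝ) < n := Nat.cast_pos.2 hn0
    have h2 : m n + c * s n = n * (m n / n + c * (s n / n)) := by field_simp
    rw [h2]
    positivity
  constructor
  · simpa only [neg_mul, ← sub_eq_add_neg, hδ] using hcurve (-stdNormalCDFInv δ)
  · have := tendsto_privacyCurveInv_of_tendsto hSm hspos hnonneg
      (fun _ _ hab => sub_lt_sub_left (strictMono_stdNormalCDF hab) 1) hcurve (-stdNormalCDFInv δ)
    simpa only [hδ] using this
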